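/- **Setting.** Let $\mathcal X$ be a countable set of types and let $\beta>0$. Each type $x\in\mathcal X$ has an out-degree $d_x^-\in\mathbb N_0$, an in-degree $d_x^+\in\mathbb N_0$, an initial capital $\gamma_x>0$, deposits $\delta_x\in\mathbb R$, a continuous non-decreasing premium function $\alpha_x:[0,\infty)\to\mathbb R$, a shock distribution on $[0,1]$ with a density and distribution function $F_x^{(\epsilon)}$, and a distribution $F_x$ of losses on $(0,\infty)$ with a density. Put $$q_{x,0}:=1-F_x^{(\epsilon)}\Bigl(\frac{\gamma_x+\alpha_x(0)-\delta_x}{\gamma_x}\Bigr),$$ the probability that an agent of type $x$ is ruined initially. For every $n$ let the agents $1,\dots,n$ have types $x_1,\dots,x_n$ (depending on $n$) with $\sum_i d_{x_i}^+=\sum_i d_{x_i}^-$, and let $\mu_x^{(n)}$ be the fraction of agents of type $x$. **Loss reveal process.** Agent $i$ has $d^-_{x_i}$ outgoing and $d^+_{x_i}$ incoming half-edges, and the outgoing half-edges are matched with the incoming ones by a uniformly random bijection (configuration model). The shocks $\epsilon_i\sim F^{(\epsilon)}_{x_i}$, the losses $L_h\sim F_{x_i}$ (one for each incoming half-edge $h$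 of each agent $i$) and the matching are all independent. The capital of agent $i$ at time $t$ is $\gamma_{x_i}(1-\epsilon_i)+\alpha_{x_i}(t)-\delta_{x_i}$ minus the losses of those of its incoming half-edges that have been revealed up to time $t$. Agents with capital $\le 0$ at time $0$ are ruined initially. An outgoing half-edge is called ruinous if its agent is ruined; let $W_n(t)$ be the number of unrevealed ruinous half-edges at time $t$. As long as $W_n>0$, the next reveal occurs after a waiting time which, given the past, is exponential with parameter $\mathcal R_n=\beta W_n$ (the value of $W_n$ just after the previous reveal, or at time $0$); then one of the unrevealed ruinous half-edges is revealed (selected by an arbitrary, possibly randomized, rule whose randomness is independent of everything else, and whose choice depends only on the number of previous reveals and on the current set of unrevealed ruinous half-edges), the incoming half-edge matched with it incurs its loss, and the agent of this incoming half-edge is ruined from then on if its capital is now $\le 0$. Let $\tau^\star_n:=\inf\{t\ge 0: W_n(t)=0\}$. **Lemma.** Assume that $\mu^{(n)}_x\to\mu_x$ as $n\to\infty$ for every $x\in\mathcal X$, where $\mu$ is a probability distribution on $\mathcal X$, that $\sum_{i=1}^n(d^+_{x_i}+d^-_{x_i})^2=O(n)$, and that $$\mathfrak R^\star(0):=\beta\sum_{x\in\mathcal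 X}\mu_x d_x^- q_{x,0}>0 .$$ Then for every $\varepsilon>0$, $$\lim_{n\to\infty}\mathbb P\Bigl(\tau^\star_n>\frac{1-\varepsilon}{\beta}\log n\Bigr)=1 .$$ In particular, for $\beta=1$, $\tau^\star_n>(1-\varepsilon)\log n$ with high probability. -/

import Mathlib

open MeasureTheory ProbabilityTheory Filter Topology
open scoped NNReal ENNReal

noncomputable section

namespace NetworkedRisk

/-- The type-dependent parameters of networked risk processes over a set of types `X`. -/
structure Params (X : Type*) where
  /-- number of outgoing links `d⁻` of an agent of the given type -/
  outDeg : X → ℕ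
  /-- number of incoming links `d⁺` of an agent of the given type -/
  inDeg : X → ℕ
  /-- initial capital `γ` -/
  capital : X → ℝ
  capital_pos : ∀ x, 0 < capital x
  /-- claims of end-users (deposits) `δ` -/
  deposit : X → ℝ
  /-- premium accumulation `t ↦ α(t)`, `t ≥ 0` -/
  premium : X → ℝ≥0 → ℝ
  premium_continuous : ∀ x, Continuous (premium x)
  premium_mono : ∀ x, Monotone (premium x)
  /-- law of the proportional exogenous shock, which has a density and lives on `[0,1]` -/
  shockLaw : X → Measure ℝ
  shockLaw_prob : ∀ x, IsProbabilityMeasure (shockLaw x)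
  shockLaw_ac : ∀ x, shockLaw x ≪ volume
  shockLaw_supp : ∀ x, shockLaw x (Set.Icc 0 1)ᶜ = 0
  /-- law of an incoming loss, which has a density and is positive -/
  lossLaw : X → Measure ℝ
  lossLaw_prob : ∀ x, IsProbabilityMeasure (lossLaw x)
  lossLaw_ac : ∀ x, lossLaw x ≪ volume
  lossLaw_pos : ∀ x, lossLaw x (Set.Iic 0) = 0

attribute [instance] Params.shockLaw_prob Params.lossLaw_prob

variable {X : Type*}

/-- `q_{x,0} = 1 - F_x^{(ε)}((γ_x + α_x(0) - δ_x) / γ_x)`: the expected fraction of initially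
ruined agents among the agents of type `x`. -/
def Params.q₀ (M : Params X) (x : X) : ℝ :=
  1 - cdf (M.shockLaw x) ((M.capital x + M.premium x 0 - M.deposit x) / M.capital x)

/-- The initial value `β ∑ₓ μ_x d⁻_x q_{x,0}` of the limiting loss reveal intensity. -/
def Params.initialIntensity (M : Params X) (β : ℝ) (μ : X → ℝ) : ℝ :=
  β * ∑' x, μ x * M.outDeg x * M.q₀ x

open Classical in
/-- The fraction of agents of type `x` among `n` agents with types `ty`. -/
def typeFraction {n : ℕ} (ty : Fin n → X) (x : X) : ℝ :=
  ((Finset.univ.filter fun i => ty i = x).card : ℝ) / n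

section Network

variable (M : Params X) {n : ℕ} (ty : Fin n → X)

/-- Outgoing half-edges. -/
abbrev OutHalf : Type := Σ i : Fin n, Fin (M.outDeg (ty i))

/-- Incoming half-edges. -/
abbrev InHalf : Type := Σ i : Fin n, Fin (M.inDeg (ty i))

/-- A configuration: a perfect matching of the outgoing with the incoming half-edges. -/
def Configuration : Type := OutHalf M ty ≃ InHalf M ty

instance : MeasurableSpace (Configuration M ty) := ⊤

/-- A rule that tells, for the `k`-th reveal and for the nonempty set of unrevealed ruinous
half-edges, which of these half-edges is revealed. -/
abbrev Selector : Type :=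
  ℕ → ∀ s : {s : Finset (OutHalf M ty) // s.Nonempty}, {h : OutHalf M ty // h ∈ s.1}

/-- All the randomness of the loss reveal process: the shocks of the agents, the losses attached
to the incoming half-edges, the configuration, the order in which ruinous half-edges are
revealed, and the standard exponential clocks. -/
abbrev Sample : Type :=
  (Fin n → ℝ) × (InHalf M ty → ℝ) × Configuration M ty × Selector M ty × (ℕ → ℝ)

/-- The law of the randomness. All components are independent; shocks and losses have the laws
prescribed by the types, the configuration is uniform (the configuration model), the clocks are
i.i.d. `Exp(1)`, and the selection rule has an arbitrary law `κ`. -/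
def sampleLaw (κ : Measure (Selector M ty)) : Measure (Sample M ty) :=
  (Measure.pi fun i => M.shockLaw (ty i)).prod
    ((Measure.pi fun h : InHalf M ty => M.lossLaw (ty h.1)).prod
      ((uniformOn (Set.univ : Set (Configuration M ty))).prod
        (κ.prod (Measure.infinitePi fun _ : ℕ => expMeasure 1))))

variable {M ty}

/-- The shock of agent `i`. -/
def Sample.shock (ω : Sample M ty) (i : Fin n) : ℝ := ω.1 i

/-- The loss incurred through the incoming half-edge `h` once it is revealed. -/
def Sample.loss (ω : Sample M ty) (h : InHalf M ty) : ℝ := ω.2.1 h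

/-- The incoming half-edge matched with the outgoing half-edge `h`. -/
def Sample.partner (ω : Sample M ty) (h : OutHalf M ty) : InHalf M ty :=
  Equiv.toFun ω.2.2.1 h

/-- The selection rule. -/
def Sample.selector (ω : Sample M ty) : Selector M ty := ω.2.2.2.1

/-- The clock of the `k`-th reveal. -/
def Sample.clock (ω : Sample M ty) (k : ℕ) : ℝ := ω.2.2.2.2 k

variable (M ty)

/-- The state of the loss reveal process just after a reveal. -/
structure State where
  /-- time of the last reveal (`0` initially) -/
  time : ℝ
  /-- the ruinous outgoing half-edges revealed so far -/
  revealed : Finset (OutHalf M ty)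
  /-- the agents ruined so far -/
  ruined : Finset (Fin n)

variable {M ty}

/-- The remaining (unrevealed) ruinous outgoing half-edges. -/
def State.ruinous (s : State M ty) : Finset (OutHalf M ty) :=
  Finset.univ.filter fun h => h.1 ∈ s.ruined ∧ h ∉ s.revealed

/-- The number of remaining ruinous outgoing half-edges. -/
def State.numRuinous (s : State M ty) : ℕ := s.ruinous.card

/-- The capital of agent `i` at time `t` when the links in `A` have been revealed:
`γ_i (1 - ε_i) + α_i(t) - δ_i` minus the losses incurred through `A`. -/
def capitalAt (ω : Sample M ty) (A : Finset (OutHalf M ty)) (t : ℝ) (i : Fin n) : ℝ :=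
  M.capital (ty i) * (1 - ω.shock i) + M.premium (ty i) t.toNNReal - M.deposit (ty i)
    - ∑ h ∈ A.filter fun h => (ω.partner h).1 = i, ω.loss (ω.partner h)

/-- The initial state: the ruined agents are those with nonpositive capital after the shock. -/
def initialState (ω : Sample M ty) : State M ty where
  time := 0
  revealed := ∅
  ruined := Finset.univ.filter fun i => capitalAt ω ∅ 0 i ≤ 0

/-- The `k`-th loss reveal, for the reveal intensity `R` (a function of the current state).
The waiting time is `Exp(R)`-distributed given the current state, being a standard exponential
clock divided by `R`. Then one ruinous half-edge `e` is revealed and its counterparty incurs the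
corresponding loss; it is ruined if its capital gets nonpositive. Nothing happens any more
once there is no ruinous half-edge left. -/
def step (R : State M ty → ℝ) (ω : Sample M ty) (k : ℕ) (s : State M ty) : State M ty :=
  if hs : s.ruinous.Nonempty then
    let t := s.time + ω.clock k / R s
    let e : OutHalf M ty := (ω.selector k ⟨s.ruinous, hs⟩).1
    let A := insert e s.revealed
    let j := (ω.partner e).1
    { time := t
      revealed := A
      ruined := if capitalAt ω A t j ≤ 0 then insert j s.ruined else s.ruined }
  else s

/-- The state after `k` reveals. -/
def stateAfter (R : State M ty → ℝ) (ω : Sample M ty) : ℕ → State M ty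
  | 0 => initialState ω
  | k + 1 => step R ω k (stateAfter R ω k)

/-- The state at time `t`, i.e. just after the last reveal up to time `t`. There are never more
reveals than outgoing half-edges. -/
def stateAt (R : State M ty → ℝ) (ω : Sample M ty) (t : ℝ) : State M ty :=
  open Classical in
  stateAfter R ω
    (Nat.findGreatest (fun k => (stateAfter R ω k).time ≤ t) (Fintype.card (OutHalf M ty)))

/-- `W_n(t)`: the number of remaining ruinous outgoing half-edges at time `t`. -/
def numRuinousAt (R : State M ty → ℝ) (ω : Sample M ty) (t : ℝ) : ℕ :=
  (stateAt R ω t).numRuinous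

/-- The cascade stopping time `τ*_n`: the first time when no ruinous half-edge remains. -/
def stoppingTime (R : State M ty → ℝ) (ω : Sample M ty) : ℝ :=
  sInf {t : ℝ | 0 ≤ t ∧ numRuinousAt R ω t = 0}

/-- The reveal intensity `R_n = β W_n` of the networked risk processes, in which every ruinous
half-edge is revealed after an independent `Exp(β)` delay. -/
def networkIntensity (β : ℝ) (s : State M ty) : ℝ := β * s.numRuinous

end Network

end NetworkedRisk

end

/-! A reveal lowers the number `W` of ruinous half-edges by at most one; new ruins only raise it. So
the cascade lasts at least as long as a pure death process of rate `β W`, which needs about `log W₀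
/ β`, and `W₀` is of order `n`. Losses, matching and selection rule play no further part.

This comparison is made without a coupling, through the potential `exp (-β t) / (W + 1)`. From `W ≥
1` the next value is at most `exp (-β t) / W` times `exp (-E / W)` with `E` a standard exponential
variable, and `𝔼 exp (-E / W) = W / (W + 1)`. Hence the potential is a supermartingale
(`lintegral_potential_stateAfter_le`). At the end `W = 0` and it equals `exp (-β T)`, where `T` is
the time of the last reveal and `T ≤ τ*`. Markov's inequality gives `P(T ≤ t) ≤ exp (β t) 𝔼[1 / (W₀
+ 1)]`.

Positivity of the initial intensity provides one type `x` with positive frequency, out-degree and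
ruin probability. Its `m` agents suffer independent shocks, and size-biasing
(`sum_measure_mul_lintegral_inv_one_add_card_le`) yields `𝔼[1 / (W₀ + 1)] ≤ 1 / (m q₀)`. With `t =
(1 - ε) / β * log n` the bound is of order `n ^ (-ε)`. -/

namespace NetworkedRisk

/-! ### Pathwise properties of the cascade -/

section Deterministic

variable {X : Type*} {M : Params X} {n : ℕ} {ty : Fin n → X}

theorem step_of_ruinous_eq_empty (R : State M ty → ℝ) (ω : Sample M ty) (k : ℕ) {s : State M ty}
    (hs : s.ruinous = ∅) : step R ω k s = s := by
  simp [step, hs]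

theorem time_step (R : State M ty → ℝ) (ω : Sample M ty) (k : ℕ) {s : State M ty}
    (hs : s.ruinous.Nonempty) : (step R ω k s).time = s.time + ω.clock k / R s := by
  simp [step, hs]

theorem revealed_step (R : State M ty → ℝ) (ω : Sample M ty) (k : ℕ) {s : State M ty}
    (hs : s.ruinous.Nonempty) :
    (step R ω k s).revealed = insert (ω.selector k ⟨s.ruinous, hs⟩).1 s.revealed := by
  simp [step, hs]

theorem ruined_subset_ruined_step (R : State M ty → ℝ) (ω : Sample M ty) (k : ℕ)
    (s : State M ty) : s.ruined ⊆ (step R ω k s).ruined := by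
  unfold step
  split_ifs with hs
  · dsimp only
    split_ifs
    · exact Finset.subset_insert _ _
    · exact Finset.Subset.refl _
  · exact Finset.Subset.refl _

/-- A reveal removes at most one ruinous half-edge. -/
theorem numRuinous_le_numRuinous_step_add_one (R : State M ty → ℝ) (ω : Sample M ty) (k : ℕ)
    (s : State M ty) : s.numRuinous ≤ (step R ω k s).numRuinous + 1 := by
  by_cases hs : s.ruinous.Nonempty
  · set e := (ω.selector k ⟨s.ruinous, hs⟩).1
    have hsub : s.ruinous ⊆ insert e (step R ω k s).ruinous := by
      intro h hh
      rw [Finset.mem_insert]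
      by_cases he : h = e
      · exact .inl he
      · right
        simp only [State.ruinous, Finset.mem_filter, Finset.mem_univ, true_and] at hh ⊢
        refine ⟨ruined_subset_ruined_step R ω k s hh.1, ?_⟩
        rw [revealed_step R ω k hs, Finset.mem_insert, not_or]
        exact ⟨he, hh.2⟩
    exact (Finset.card_le_card hsub).trans (Finset.card_insert_le _ _)
  · rw [step_of_ruinous_eq_empty R ω k (Finset.not_nonempty_iff_eq_empty.mp hs)]
    exact Nat.le_succ _

theorem stateAfter_add_of_ruinous_eq_empty (R : State M ty → ℝ) (ω : Sample M ty) {k : ℕ}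
    (hk : (stateAfter R ω k).ruinous = ∅) (j : ℕ) :
    stateAfter R ω (k + j) = stateAfter R ω k := by
  induction j with
  | zero => rfl
  | succ j ih =>
    rw [← add_assoc, stateAfter, ih, step_of_ruinous_eq_empty R ω _ hk]

/-- Every selected half-edge is unrevealed, so each reveal enlarges the revealed set as long as the
cascade is alive. -/
theorem le_card_revealed_stateAfter (R : State M ty → ℝ) (ω : Sample M ty) (k : ℕ)
    (hk : (stateAfter R ω k).ruinous.Nonempty) : k ≤ (stateAfter R ω k).revealed.card := by
  induction k with
  | zero => exact Nat.zero_le _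
  | succ k ih =>
    by_cases hs : (stateAfter R ω k).ruinous.Nonempty
    · have he := ((ω.selector k ⟨_, hs⟩).2)
      have he' := (Finset.mem_filter.mp he).2.2
      rw [stateAfter, revealed_step R ω k hs, Finset.card_insert_of_notMem he']
      exact Nat.succ_le_succ (ih hs)
    · have := stateAfter_add_of_ruinous_eq_empty R ω (Finset.not_nonempty_iff_eq_empty.mp hs) 1
      rw [this] at hk
      exact absurd hk hs

/-- There are no ruinous half-edges left after as many reveals as there are half-edges. -/
theorem ruinous_stateAfter_card (R : State M ty → ℝ) (ω : Sample M ty) :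
    (stateAfter R ω (Fintype.card (OutHalf M ty))).ruinous = ∅ := by
  by_contra hne
  have hne' := Finset.nonempty_iff_ne_empty.mpr hne
  have hcard := le_card_revealed_stateAfter R ω _ hne'
  have huniv := Finset.eq_univ_of_card _ (le_antisymm (Finset.card_le_univ _) hcard)
  obtain ⟨h, hh⟩ := hne'
  simp only [State.ruinous, Finset.mem_filter, huniv, Finset.mem_univ, not_true_eq_false,
    and_false] at hh

/-- The cascade does not stop before the time of the last reveal. -/
theorem time_stateAfter_card_le_stoppingTime (R : State M ty → ℝ) (ω : Sample M ty) :
    (stateAfter R ω (Fintype.card (OutHalf M ty))).time ≤ stoppingTime R ω := by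
  classical
  set N := Fintype.card (OutHalf M ty) with hN
  -- The infimum must be over a nonempty set, as `sInf ∅ = 0`. The clocks are arbitrary reals here,
  -- so the last time may be negative; hence the maximum with `0`.
  refine le_csInf ⟨max (stateAfter R ω N).time 0, le_max_right _ _, ?_⟩ ?_
  · have h : Nat.findGreatest (fun k => (stateAfter R ω k).time ≤ max (stateAfter R ω N).time 0) N
        = N := Nat.findGreatest_eq (le_max_left _ _)
    unfold numRuinousAt stateAt
    simp only [← hN]
    have h' : ∀ k, k = N → (stateAfter R ω k).numRuinous = 0 := by
      rintro k rfl
      rw [State.numRuinous, Finset.card_eq_zero]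
      exact ruinous_stateAfter_card R ω
    apply h'
    convert h
  · rintro t ⟨ht0, ht⟩
    unfold numRuinousAt stateAt at ht
    set k := Nat.findGreatest (fun k => (stateAfter R ω k).time ≤ t)
      (Fintype.card (OutHalf M ty)) with hk
    have hkN : k ≤ N := Nat.findGreatest_le _
    have hkt : (stateAfter R ω k).time ≤ t :=
      Nat.findGreatest_spec (P := fun k => (stateAfter R ω k).time ≤ t) (Nat.zero_le N)
        (by exact ht0)
    have hr : (stateAfter R ω k).ruinous = ∅ := by
      rw [← Finset.card_eq_zero]
      exact ht
    -- The state is frozen from `k` on, so the final time is the `k`-th time; no monotonicity of the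
    -- times is needed.
    have h := stateAfter_add_of_ruinous_eq_empty R ω hr (N - k)
    rw [Nat.add_sub_cancel' hkN] at h
    rw [h]
    exact hkt

/-- Changing the clocks from the `k`-th on does not affect the first `k` reveals. -/
theorem stateAfter_congr_clock (R : State M ty → ℝ) (a : Fin n → ℝ) (b : InHalf M ty → ℝ)
    (σ : Configuration M ty) (S : Selector M ty) {c c' : ℕ → ℝ} {k : ℕ}
    (h : ∀ i < k, c i = c' i) :
    stateAfter R ((a, b, σ, S, c) : Sample M ty) k = stateAfter R (a, b, σ, S, c') k := by
  induction k with
  | zero => rfl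
  | succ k ih =>
    rw [stateAfter, stateAfter, ih fun i hi => h i (hi.trans (Nat.lt_succ_self k))]
    have hk : c k = c' k := h k (Nat.lt_succ_self k)
    simp only [step, Sample.clock, hk]
    rfl

/-- Every initially ruined agent with outgoing half-edges contributes to the initial number of
ruinous half-edges. -/
theorem card_le_numRuinous_initialState (ω : Sample M ty) (s : Finset (Fin n))
    (hdeg : ∀ i ∈ s, 0 < M.outDeg (ty i)) (hcap : ∀ i ∈ s, capitalAt ω ∅ 0 i ≤ 0) :
    s.card ≤ (initialState ω).numRuinous := by
  refine Finset.card_le_card_of_surjOn (fun h => h.1) ?_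
  intro i hi
  refine ⟨⟨i, ⟨0, hdeg i hi⟩⟩, ?_, rfl⟩
  simp [State.ruinous, initialState, hcap i hi]

end Deterministic

/-! ### Measurability of the state in the randomness -/

section Measurability

/-- A set is measurable if it agrees with a measurable set on each piece of a countable
measurable partition. -/
theorem measurableSet_of_fibers {α D : Type*} [MeasurableSpace α] [Countable D] (g : α → D)
    (hg : ∀ d, MeasurableSet {a | g a = d}) {T : Set α}
    (h : ∀ d, ∃ S, MeasurableSet S ∧ ∀ a, g a = d → (a ∈ T ↔ a ∈ S)) : MeasurableSet T := by
  choose S hS hT using h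
  have : T = ⋃ d, {a | g a = d} ∩ S d := by
    ext a
    simp only [Set.mem_iUnion, Set.mem_inter_iff, Set.mem_ofPred_eq, exists_eq_left']
    exact hT _ a rfl
  rw [this]
  exact .iUnion fun d => (hg d).inter (hS d)

/-- A function is measurable if it agrees with a measurable function on each piece of a countable
measurable partition. -/
theorem measurable_of_fibers {α D γ : Type*} [MeasurableSpace α] [MeasurableSpace γ] [Countable D]
    (g : α → D) (hg : ∀ d, MeasurableSet {a | g a = d}) {f : α → γ}
    (h : ∀ d, ∃ f' : α → γ, Measurable f' ∧ ∀ a, g a = d → f a = f' a) : Measurable f := by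
  intro S hS
  refine measurableSet_of_fibers g hg fun d => ?_
  obtain ⟨f', hf', hff'⟩ := h d
  exact ⟨f' ⁻¹' S, hf' hS, fun a ha => by simp [hff' a ha]⟩

variable {X : Type*} {M : Params X} {n : ℕ} {ty : Fin n → X}

instance : Finite (Configuration M ty) :=
  inferInstanceAs (Finite (OutHalf M ty ≃ InHalf M ty))

theorem measurableSet_configuration_eq (σ : Configuration M ty) :
    MeasurableSet {ω : Sample M ty | ω.2.2.1 = σ} := by
  have : Measurable fun ω : Sample M ty => ω.2.2.1 := by fun_prop
  exact this (MeasurableSpace.measurableSet_top (s := {σ}))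

theorem measurableSet_selector_eq (k : ℕ) (s : {s : Finset (OutHalf M ty) // s.Nonempty})
    (e : OutHalf M ty) : MeasurableSet {ω : Sample M ty | (ω.selector k s).1 = e} := by
  have : Measurable fun ω : Sample M ty => (ω.selector k s).1 := by
    unfold Sample.selector
    fun_prop
  have he : MeasurableSet ({e} : Set (OutHalf M ty)) :=
    MeasurableSpace.measurableSet_iInf.mpr fun i => MeasurableSpace.measurableSet_top
  exact this he

/-- For fixed configuration and revealed links, the capital is a measurable function of the shocks,
the losses and time. -/
theorem measurable_capitalAt_of_configuration (σ : Configuration M ty)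
    (A : Finset (OutHalf M ty)) (j : Fin n) {t : Sample M ty → ℝ} (ht : Measurable t) :
    ∃ f : Sample M ty → ℝ, Measurable f ∧ ∀ ω, ω.2.2.1 = σ → capitalAt ω A (t ω) j = f ω := by
  classical
  refine ⟨fun ω => M.capital (ty j) * (1 - ω.1 j) + M.premium (ty j) (t ω).toNNReal
      - M.deposit (ty j) - ∑ h ∈ A.filter fun h => (Equiv.toFun σ h).1 = j,
        ω.2.1 (Equiv.toFun σ h), ?_, ?_⟩
  · have := (M.premium_continuous (ty j)).measurable.comp ht.real_toNNReal
    refine ((Measurable.add (by fun_prop) this).sub (by fun_prop)).sub ?_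
    exact Finset.measurable_sum _ fun h _ => by fun_prop
  · rintro ω rfl
    rfl

theorem measurableSet_ruined_initialState (B : Finset (Fin n)) :
    MeasurableSet {ω : Sample M ty | (initialState ω).ruined = B} := by
  have hcap : ∀ i, MeasurableSet {ω : Sample M ty | capitalAt ω ∅ 0 i ≤ 0} := by
    intro i
    refine measurableSet_le ?_ measurable_const
    simp only [capitalAt, Sample.shock, Finset.filter_empty, Finset.sum_empty]
    fun_prop
  have : {ω : Sample M ty | (initialState ω).ruined = B} =
      ⋂ i, {ω : Sample M ty | capitalAt ω ∅ 0 i ≤ 0 ↔ i ∈ B} := by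
    ext ω
    simp [initialState, Finset.ext_iff]
  rw [this]
  refine .iInter fun i => ?_
  by_cases hi : i ∈ B
  · simpa [hi] using hcap i
  · simp only [hi, iff_false]
    exact (hcap i).compl

/-- The state after `k` reveals depends measurably on the randomness. -/
theorem measurable_stateAfter (R : State M ty → ℝ)
    (hR : ∀ s s' : State M ty, s.revealed = s'.revealed → s.ruined = s'.ruined → R s = R s')
    (k : ℕ) :
    Measurable (fun ω : Sample M ty => (stateAfter R ω k).time) ∧
      ∀ A B, MeasurableSet {ω : Sample M ty |
        (stateAfter R ω k).revealed = A ∧ (stateAfter R ω k).ruined = B} := by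
  classical
  induction k with
  | zero =>
    refine ⟨measurable_const, fun A B => ?_⟩
    exact (MeasurableSet.const (∅ = A)).inter (measurableSet_ruined_initialState B)
  | succ k ih =>
    obtain ⟨hT, hS⟩ := ih
    -- The discrete part of the state takes finitely many values. Where it is fixed, so are the
    -- ruinous set and the intensity.
    let g₁ : Sample M ty → Finset (OutHalf M ty) × Finset (Fin n) := fun ω =>
      ((stateAfter R ω k).revealed, (stateAfter R ω k).ruined)
    have hg₁ : ∀ d, MeasurableSet {ω | g₁ ω = d} := by
      rintro ⟨A, B⟩
      simpa [g₁, Prod.ext_iff] using hS A B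
    have hruin : ∀ d ω, g₁ ω = d →
        (stateAfter R ω k).ruinous = (⟨0, d.1, d.2⟩ : State M ty).ruinous := by
      rintro _ ω rfl
      rfl
    have hRat : ∀ d ω, g₁ ω = d → R (stateAfter R ω k) = R ⟨0, d.1, d.2⟩ := by
      rintro _ ω rfl
      exact hR _ _ rfl rfl
    have htime : Measurable fun ω : Sample M ty => (stateAfter R ω (k + 1)).time := by
      refine measurable_of_fibers g₁ hg₁ fun d => ?_
      by_cases hd : (⟨0, d.1, d.2⟩ : State M ty).ruinous.Nonempty
      · refine ⟨fun ω => (stateAfter R ω k).time + ω.clock k / R ⟨0, d.1, d.2⟩, ?_, ?_⟩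
        · refine hT.add (Measurable.div_const ?_ _)
          unfold Sample.clock
          fun_prop
        · intro ω hω
          rw [stateAfter, time_step R ω k (by rwa [hruin d ω hω]), hRat d ω hω]
      · refine ⟨_, hT, fun ω hω => ?_⟩
        rw [stateAfter, step_of_ruinous_eq_empty]
        rw [hruin d ω hω]
        exact Finset.not_nonempty_iff_eq_empty.mp hd
    refine ⟨htime, fun A B => ?_⟩
    refine measurableSet_of_fibers g₁ hg₁ fun d => ?_
    by_cases hd : (⟨0, d.1, d.2⟩ : State M ty).ruinous.Nonempty
    · let g₂ : Sample M ty → Configuration M ty × OutHalf M ty := fun ω =>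
        (ω.2.2.1, (ω.selector k ⟨_, hd⟩).1)
      have hg₂ : ∀ d, MeasurableSet {ω | g₂ ω = d} := by
        rintro ⟨σ, e⟩
        simp only [g₂, Prod.ext_iff]
        exact (measurableSet_configuration_eq σ).inter (measurableSet_selector_eq k ⟨_, hd⟩ e)
      have hcap : ∀ σ A j, ∃ f : Sample M ty → ℝ, Measurable f ∧ ∀ ω, ω.2.2.1 = σ →
          capitalAt ω A (stateAfter R ω (k + 1)).time j = f ω := fun σ A j =>
        measurable_capitalAt_of_configuration σ A j htime
      let A' : OutHalf M ty → Finset (OutHalf M ty) := fun e => insert e d.1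
      let T : Set (Sample M ty) := {ω | A' (g₂ ω).2 = A ∧
        (if capitalAt ω (A' (g₂ ω).2) (stateAfter R ω (k + 1)).time
            (Equiv.toFun (g₂ ω).1 (g₂ ω).2).1 ≤ 0
          then insert (Equiv.toFun (g₂ ω).1 (g₂ ω).2).1 d.2 else d.2) = B}
      refine ⟨T, ?_, ?_⟩
      · refine measurableSet_of_fibers g₂ hg₂ ?_
        rintro ⟨σ, e⟩
        obtain ⟨f, hf, hfe⟩ := hcap σ (A' e) (Equiv.toFun σ e).1
        have hset : MeasurableSet
            {ω | (if f ω ≤ 0 then insert (Equiv.toFun σ e).1 d.2 else d.2) = B} := by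
          have hle : MeasurableSet {ω | f ω ≤ 0} := measurableSet_le hf measurable_const
          have : {ω | (if f ω ≤ 0 then insert (Equiv.toFun σ e).1 d.2 else d.2) = B} =
              ({ω | f ω ≤ 0} ∩ {_ω | insert (Equiv.toFun σ e).1 d.2 = B}) ∪
                ({ω | f ω ≤ 0}ᶜ ∩ {_ω | d.2 = B}) := by
            ext ω
            by_cases h : f ω ≤ 0 <;> simp [h]
          rw [this]
          exact (hle.inter (.const _)).union (hle.compl.inter (.const _))
        refine ⟨{ω | A' e = A ∧ (if f ω ≤ 0 then insert (Equiv.toFun σ e).1 d.2 else d.2) = B},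
          (MeasurableSet.const _).inter hset, fun ω hω => ?_⟩
        have h1 : ω.2.2.1 = σ := congrArg Prod.fst hω
        simp only [T, Set.mem_ofPred_eq, hω, hfe ω h1]
      · intro ω hω
        have hd' : (stateAfter R ω k).ruinous.Nonempty := by rwa [hruin d ω hω]
        have hsel : (ω.selector k ⟨_, hd'⟩).1 = (ω.selector k ⟨_, hd⟩).1 := by
          have : (⟨_, hd'⟩ : {s : Finset (OutHalf M ty) // s.Nonempty}) = ⟨_, hd⟩ :=
            Subtype.ext (hruin d ω hω)
          rw [this]
        have h1 : (stateAfter R ω k).revealed = d.1 := congrArg Prod.fst hω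
        have h2 : (stateAfter R ω k).ruined = d.2 := congrArg Prod.snd hω
        have htm : (stateAfter R ω (k + 1)).time
            = (stateAfter R ω k).time + ω.clock k / R (stateAfter R ω k) :=
          time_step R ω k hd'
        simp only [T, Set.mem_ofPred_eq, htm, g₂, A']
        rw [stateAfter, step, dif_pos hd']
        simp only [hsel, h1, h2]
        rfl
    · refine ⟨_, hS A B, fun ω hω => ?_⟩
      have : stateAfter R ω (k + 1) = stateAfter R ω k := by
        rw [stateAfter, step_of_ruinous_eq_empty]
        rw [hruin d ω hω]
        exact Finset.not_nonempty_iff_eq_empty.mp hd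
      simp only [Set.mem_ofPred_eq, this]

theorem networkIntensity_congr (β : ℝ) (s s' : State M ty) (h : s.revealed = s'.revealed)
    (h' : s.ruined = s'.ruined) : networkIntensity β s = networkIntensity β s' := by
  simp [networkIntensity, State.numRuinous, State.ruinous, h, h']

theorem measurable_numRuinous_stateAfter (β : ℝ) (k : ℕ) :
    Measurable fun ω : Sample M ty =>
      ((stateAfter (networkIntensity β) ω k).numRuinous : ℝ) := by
  refine measurable_of_fibers (fun ω : Sample M ty =>
    ((stateAfter (networkIntensity β) ω k).revealed,
      (stateAfter (networkIntensity β) ω k).ruined)) ?_ fun d => ?_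
  · rintro ⟨A, B⟩
    simpa [Prod.ext_iff] using (measurable_stateAfter _ (networkIntensity_congr β) k).2 A B
  · refine ⟨fun _ => ((⟨0, d.1, d.2⟩ : State M ty).numRuinous : ℝ), measurable_const, ?_⟩
    rintro ω rfl
    rfl

end Measurability

/-! ### Exponential clocks and the supermartingale -/

section Clocks

/-- Resampling one coordinate leaves a product measure invariant. -/
theorem measurePreserving_update_infinitePi {ι : Type*} [DecidableEq ι] {E : ι → Type*}
    [∀ i, MeasurableSpace (E i)] (ν : ∀ i, Measure (E i)) [∀ i, IsProbabilityMeasure (ν i)]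
    (k : ι) :
    MeasurePreserving (fun p : (∀ i, E i) × E k => Function.update p.1 k p.2)
      ((Measure.infinitePi ν).prod (ν k)) (Measure.infinitePi ν) := by
  have hmeas : Measurable fun p : (∀ i, E i) × E k => Function.update p.1 k p.2 := by
    refine measurable_pi_lambda _ fun i => ?_
    by_cases h : i = k
    · subst h
      simpa using measurable_snd
    · simp only [Function.update_of_ne h]
      fun_prop
  refine ⟨hmeas, Measure.eq_infinitePi ν fun s t ht => ?_⟩
  rw [Measure.map_apply hmeas (.pi s.countable_toSet fun i _ => ht i)]
  by_cases hk : k ∈ s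
  · have : (fun p : (∀ i, E i) × E k => Function.update p.1 k p.2) ⁻¹' (Set.pi s t) =
        (Set.pi (s.erase k : Finset ι) t) ×ˢ t k := by
      ext ⟨c, e⟩
      simp only [Set.mem_preimage, Set.mem_pi, Finset.mem_coe, Set.mem_prod, Finset.mem_erase]
      constructor
      · intro h
        refine ⟨fun i hi => ?_, by simpa using h k hk⟩
        simpa [hi.1] using h i hi.2
      · rintro ⟨h, he⟩ i hi
        by_cases hik : i = k
        · subst hik
          simpa using he
        · simpa [hik] using h i ⟨hik, hi⟩
    rw [this, Measure.prod_prod, Measure.infinitePi_pi ν fun i _ => ht i,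
      Finset.prod_erase_mul s (fun i => ν i (t i)) hk]
  · have : (fun p : (∀ i, E i) × E k => Function.update p.1 k p.2) ⁻¹' (Set.pi s t) =
        (Set.pi s t) ×ˢ Set.univ := by
      ext ⟨c, e⟩
      simp only [Set.mem_preimage, Set.mem_pi, Finset.mem_coe, Set.mem_prod, Set.mem_univ,
        and_true]
      refine forall₂_congr fun i hi => ?_
      rw [Function.update_of_ne (ne_of_mem_of_not_mem hi hk)]
    rw [this, Measure.prod_prod, Measure.infinitePi_pi ν fun i _ => ht i, measure_univ, mul_one]

/-- The Laplace transform of the standard exponential distribution. -/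
theorem lintegral_exp_neg_mul_expMeasure {a : ℝ} (ha : 0 ≤ a) :
    ∫⁻ x, ENNReal.ofReal (Real.exp (-(a * x))) ∂(expMeasure 1) = ENNReal.ofReal (1 / (1 + a)) := by
  have hpos : 0 < 1 + a := by linarith
  have hpdf : Measurable (exponentialPDF 1) := (measurable_exponentialPDFReal 1).ennreal_ofReal
  have h1 : expMeasure 1 = volume.withDensity (exponentialPDF 1) := rfl
  rw [h1, lintegral_withDensity_eq_lintegral_mul _ hpdf (by fun_prop)]
  -- Exponential tilting: the tilted density is a multiple of the `Exp(1 + a)` density, whose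
  -- integral is one.
  have h2 : ∀ x, (exponentialPDF 1 * fun x => ENNReal.ofReal (Real.exp (-(a * x)))) x =
      ENNReal.ofReal (1 / (1 + a)) * exponentialPDF (1 + a) x := by
    intro x
    simp only [Pi.mul_apply, exponentialPDF_eq]
    rw [← ENNReal.ofReal_mul (by split_ifs <;> positivity), ← ENNReal.ofReal_mul (by positivity)]
    congr 1
    split_ifs
    · rw [one_mul, one_mul, ← Real.exp_add, ← mul_assoc, one_div, inv_mul_cancel₀ hpos.ne', one_mul]
      congr 1
      ring
    · simp
  simp_rw [h2]
  have hpdf' : Measurable (exponentialPDF (1 + a)) :=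
    (measurable_exponentialPDFReal _).ennreal_ofReal
  rw [lintegral_const_mul _ hpdf', lintegral_exponentialPDF_eq_one hpos, mul_one]

variable {X : Type*} {M : Params X} {n : ℕ} {ty : Fin n → X}

/-- The discounted potential `exp (-β t) / (W + 1)`, which is a supermartingale along the loss
reveal process. -/
noncomputable def State.potential (β : ℝ) (s : State M ty) : ℝ≥0∞ :=
  ENNReal.ofReal (Real.exp (-(β * s.time)) / (s.numRuinous + 1))

theorem measurable_potential_stateAfter (β : ℝ) (k : ℕ) :
    Measurable fun ω : Sample M ty =>
      (stateAfter (networkIntensity β) ω k).potential β := by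
  have h1 := (measurable_stateAfter (M := M) (ty := ty) _ (networkIntensity_congr β) k).1
  have h2 := measurable_numRuinous_stateAfter (M := M) (ty := ty) β k
  unfold State.potential
  fun_prop

/-- The new denominator is at least the old `W`, because at most one half-edge is lost. The factor
`β` cancels in `β * (clock / (β * W))`. -/
theorem potential_step_le {β : ℝ} (hβ : 0 < β) (ω : Sample M ty) (k : ℕ) {s : State M ty}
    (hs : s.ruinous.Nonempty) :
    (step (networkIntensity β) ω k s).potential β ≤
      ENNReal.ofReal (Real.exp (-(β * s.time)) / s.numRuinous) *
        ENNReal.ofReal (Real.exp (-((1 / s.numRuinous : ℝ) * ω.clock k))) := by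
  have hw : 0 < (s.numRuinous : ℝ) := by exact_mod_cast hs.card_pos
  have hle : (s.numRuinous : ℝ) ≤ (step (networkIntensity β) ω k s).numRuinous + 1 := by
    exact_mod_cast numRuinous_le_numRuinous_step_add_one _ ω k s
  rw [← ENNReal.ofReal_mul (by positivity)]
  refine ENNReal.ofReal_le_ofReal ?_
  rw [time_step _ ω k hs, div_mul_eq_mul_div, ← Real.exp_add]
  have : -(β * (s.time + ω.clock k / networkIntensity β s)) =
      -(β * s.time) + -((1 / s.numRuinous : ℝ) * ω.clock k) := by
    rw [networkIntensity]
    field_simp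
    ring
  rw [this]
  gcongr

/-- One supermartingale step: the Laplace transform at `1 / W` is `W / (W + 1)`, which turns `1 / W`
back into `1 / (W + 1)`. -/
theorem lintegral_potential_step_le {β : ℝ} (hβ : 0 < β) (a : Fin n → ℝ) (b : InHalf M ty → ℝ)
    (σ : Configuration M ty) (S : Selector M ty) (c : ℕ → ℝ) (k : ℕ) (s : State M ty) :
    ∫⁻ e, (step (networkIntensity β) ((a, b, σ, S, Function.update c k e) : Sample M ty) k
      s).potential β ∂(expMeasure 1) ≤ s.potential β := by
  have : IsProbabilityMeasure (expMeasure 1) := isProbabilityMeasure_expMeasure one_pos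
  by_cases hs : s.ruinous.Nonempty
  · have hw : 0 < (s.numRuinous : ℝ) := by exact_mod_cast hs.card_pos
    refine (lintegral_mono fun e => potential_step_le hβ _ k hs).trans ?_
    simp only [Sample.clock, Function.update_self]
    rw [lintegral_const_mul _ (by fun_prop), lintegral_exp_neg_mul_expMeasure (by positivity),
      ← ENNReal.ofReal_mul (by positivity)]
    refine ENNReal.ofReal_le_ofReal (le_of_eq ?_)
    field_simp
  · simp [step_of_ruinous_eq_empty _ _ k (Finset.not_nonempty_iff_eq_empty.mp hs)]

/-- The potential is a supermartingale with respect to the clocks. -/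
theorem lintegral_potential_stateAfter_le {β : ℝ} (hβ : 0 < β) (a : Fin n → ℝ)
    (b : InHalf M ty → ℝ) (σ : Configuration M ty) (S : Selector M ty) (k : ℕ) :
    ∫⁻ c, (stateAfter (networkIntensity β) ((a, b, σ, S, c) : Sample M ty) k).potential β
        ∂(Measure.infinitePi fun _ : ℕ => expMeasure 1) ≤
      ENNReal.ofReal
        (1 / ((initialState ((a, b, σ, S, 0) : Sample M ty)).numRuinous + 1)) := by
  have : IsProbabilityMeasure (expMeasure 1) := isProbabilityMeasure_expMeasure one_pos
  induction k with
  | zero =>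
    have : ∀ c, (stateAfter (networkIntensity β) ((a, b, σ, S, c) : Sample M ty) 0).potential β =
        ENNReal.ofReal
        (1 / ((initialState ((a, b, σ, S, 0) : Sample M ty)).numRuinous + 1)) := by
      intro c
      rw [stateAfter_congr_clock (c' := 0) _ a b σ S (by simp)]
      simp [State.potential, stateAfter, initialState]
    simp [this]
  | succ k ih =>
    refine le_trans ?_ ih
    have hm : ∀ k, Measurable fun c : ℕ → ℝ =>
        (stateAfter (networkIntensity β) ((a, b, σ, S, c) : Sample M ty) k).potential β :=
      fun k => (measurable_potential_stateAfter β k).comp (by fun_prop)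
    -- This replaces conditioning on the past: clock `k` is resampled and integrated first, while
    -- the first `k` reveals stay fixed.
    have hpres := measurePreserving_update_infinitePi (fun _ : ℕ => expMeasure 1) k
    rw [← hpres.lintegral_comp (hm (k + 1))]
    refine (lintegral_prod_le _).trans (lintegral_mono fun c => ?_)
    refine le_trans (le_of_eq (lintegral_congr fun e => ?_))
      (lintegral_potential_step_le hβ a b σ S c k _)
    rw [stateAfter, stateAfter_congr_clock (c' := c) _ a b σ S]
    intro i hi
    exact Function.update_of_ne hi.ne _ _

end Clocks

/-! ### Size-biasing for sums of independent indicators -/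

section InitialRuin

/-- A size-bias estimate for the number `B` of successes among independent trials:
`𝔼[1 / (1 + B)] ≤ 1 / ∑ pᵢ`. -/
theorem sum_measure_mul_lintegral_inv_one_add_card_le {Ω ι : Type*} [MeasurableSpace Ω]
    {P : Measure Ω} [IsProbabilityMeasure P] [DecidableEq ι] (s : Finset ι) (f : ι → Ω → ℝ≥0∞)
    (hf : ∀ i, Measurable (f i)) (hind : iIndepFun f P) (hval : ∀ i ω, f i ω = 0 ∨ f i ω = 1) :
    (∑ i ∈ s, ∫⁻ ω, f i ω ∂P) * ∫⁻ ω, (1 + ∑ i ∈ s, f i ω)⁻¹ ∂P ≤ 1 := by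
  have hterm : ∀ i ∈ s, (∫⁻ ω, f i ω ∂P) * ∫⁻ ω, (1 + ∑ j ∈ s, f j ω)⁻¹ ∂P ≤
      ∫⁻ ω, f i ω * (∑ j ∈ s, f j ω)⁻¹ ∂P := by
    intro i hi
    have hi' : IndepFun (f i) (fun ω => (1 + (∑ j ∈ s.erase i, f j) ω)⁻¹) P :=
      ((hind.indepFun_finsetSum_of_notMem hf (Finset.notMem_erase i s)).comp
        (φ := fun x => (1 + x)⁻¹) (ψ := id) (by fun_prop) measurable_id).symm
    have hm : Measurable fun ω => (1 + (∑ j ∈ s.erase i, f j) ω)⁻¹ := by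
      have := Finset.measurable_sum (s.erase i) fun j _ => hf j
      fun_prop
    -- Dropping the `i`-th indicator increases the inverse and makes it independent of `f i`. Where
    -- `f i = 1`, the `1 +` then stands for the dropped indicator.
    calc (∫⁻ ω, f i ω ∂P) * ∫⁻ ω, (1 + ∑ j ∈ s, f j ω)⁻¹ ∂P
        ≤ (∫⁻ ω, f i ω ∂P) * ∫⁻ ω, (1 + (∑ j ∈ s.erase i, f j) ω)⁻¹ ∂P := by
          gcongr with ω
          rw [Finset.sum_apply]
          exact Finset.sum_le_sum_of_subset (Finset.erase_subset i s)
      _ = ∫⁻ ω, f i ω * (1 + (∑ j ∈ s.erase i, f j) ω)⁻¹ ∂P :=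
          (lintegral_mul_eq_lintegral_mul_lintegral_of_indepFun'' (hf i).aemeasurable
            hm.aemeasurable hi').symm
      _ = ∫⁻ ω, f i ω * (∑ j ∈ s, f j ω)⁻¹ ∂P := by
          refine lintegral_congr fun ω => ?_
          rcases hval i ω with h | h
          · simp [h]
          · rw [← Finset.add_sum_erase s (fun j => f j ω) hi, h, Finset.sum_apply]
  rw [Finset.sum_mul]
  refine (Finset.sum_le_sum hterm).trans ?_
  rw [← lintegral_finsetSum _ fun i _ => by
    have := Finset.measurable_sum s fun j _ => hf j
    fun_prop]
  refine (lintegral_mono (g := fun _ => 1) fun ω => ?_).trans (by simp)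
  rw [← Finset.sum_mul]
  -- Only an inequality: when all indicators vanish, the product is `0 * ∞ = 0`.
  exact ENNReal.mul_inv_le_one _

end InitialRuin

/-! ### Tail bound for the time of the last reveal -/

section TailBound

variable {X : Type*} {M : Params X} {n : ℕ} {ty : Fin n → X}

/-- The relative size of a shock above which an agent of type `x` is ruined initially. -/
noncomputable def Params.ruinThreshold (M : Params X) (x : X) : ℝ :=
  (M.capital x + M.premium x 0 - M.deposit x) / M.capital x

theorem Params.shockLaw_Ioi_ruinThreshold (M : Params X) (x : X) :
    M.shockLaw x (Set.Ioi (M.ruinThreshold x)) = ENNReal.ofReal (M.q₀ x) := by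
  have h : (Set.Ioi (M.ruinThreshold x)) = (Set.Iic (M.ruinThreshold x))ᶜ := by simp
  rw [Params.q₀, cdf_eq_real, h, ← probReal_compl_eq_one_sub measurableSet_Iic]
  exact (ofReal_measureReal).symm

theorem Params.q₀_nonneg (M : Params X) (x : X) : 0 ≤ M.q₀ x :=
  sub_nonneg.mpr (cdf_le_one _ _)

theorem capitalAt_nonpos_of_ruinThreshold_lt (ω : Sample M ty) {i : Fin n}
    (h : M.ruinThreshold (ty i) < ω.shock i) : capitalAt ω ∅ 0 i ≤ 0 := by
  rw [Params.ruinThreshold, div_lt_iff₀ (M.capital_pos _)] at h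
  simp only [capitalAt, Finset.filter_empty, Finset.sum_empty, Real.toNNReal_zero]
  linarith

open Classical in
/-- The number of half-edges that are ruinous initially is at least the number of agents of type
`x` with a large shock. -/
theorem inv_one_add_numRuinous_initialState_le (ω : Sample M ty) {x : X} (hx : 0 < M.outDeg x) :
    ENNReal.ofReal (1 / ((initialState ω).numRuinous + 1)) ≤
      (1 + ∑ i with ty i = x, (Set.Ioi (M.ruinThreshold x)).indicator 1 (ω.1 i))⁻¹ := by
  have hcard : ∑ i with ty i = x, (Set.Ioi (M.ruinThreshold x)).indicator (1 : ℝ → ℝ≥0∞) (ω.1 i) =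
      ((Finset.univ.filter fun i => ty i = x ∧ M.ruinThreshold x < ω.1 i).card : ℝ≥0∞) := by
    simp [Set.indicator_apply, ← Finset.filter_filter]
  rw [hcard, one_div, ENNReal.ofReal_inv_of_pos (by positivity), ENNReal.inv_le_inv,
    ENNReal.ofReal_add (by positivity) zero_le_one, ENNReal.ofReal_one, ENNReal.ofReal_natCast,
    add_comm]
  gcongr
  refine card_le_numRuinous_initialState ω _ ?_ ?_
  · intro i hi
    rwa [(Finset.mem_filter.mp hi).2.1]
  · intro i hi
    obtain ⟨-, rfl, hi⟩ := Finset.mem_filter.mp hi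
    exact capitalAt_nonpos_of_ruinThreshold_lt ω hi

theorem lintegral_le_of_forall_le {α : Type*} [MeasurableSpace α] {ν : Measure α}
    (hν : ν Set.univ ≤ 1) {f : α → ℝ≥0∞} {C : ℝ≥0∞} (h : ∀ a, f a ≤ C) : ∫⁻ a, f a ∂ν ≤ C :=
  calc ∫⁻ a, f a ∂ν ≤ ∫⁻ _, C ∂ν := lintegral_mono h
    _ = C * ν Set.univ := lintegral_const C
    _ ≤ C := mul_le_of_le_one_right' hν

open Classical in
-- The clocks are integrated out by the supermartingale bound. What remains depends on the shocks
-- alone, so losses, matching and selector only contribute total masses at most one.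
theorem lintegral_potential_sampleLaw_le {β : ℝ} (hβ : 0 < β) (κ : Measure (Selector M ty))
    [IsProbabilityMeasure κ] {x : X} (hx : 0 < M.outDeg x) (k : ℕ) :
    ∫⁻ ω, (stateAfter (networkIntensity β) ω k).potential β ∂(sampleLaw M ty κ) ≤
      ∫⁻ a, (1 + ∑ i with ty i = x, (Set.Ioi (M.ruinThreshold x)).indicator 1 (a i))⁻¹
        ∂(Measure.pi fun i => M.shockLaw (ty i)) := by
  have : IsProbabilityMeasure (expMeasure 1) := isProbabilityMeasure_expMeasure one_pos
  refine (lintegral_prod_le _).trans (lintegral_mono fun a => ?_)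
  refine (lintegral_prod_le _).trans (lintegral_le_of_forall_le prob_le_one fun b => ?_)
  refine (lintegral_prod_le _).trans (lintegral_le_of_forall_le ?_ fun σ => ?_)
  -- Without any matching, `uniformOn` is the zero measure, which also has mass at most one.
  · rcases Set.eq_empty_or_nonempty (Set.univ : Set (Configuration M ty)) with h | h
    · simp [h]
    · have := isProbabilityMeasure_uniformOn (Set.finite_univ (α := Configuration M ty)) h
      exact prob_le_one
  refine (lintegral_prod_le _).trans (lintegral_le_of_forall_le prob_le_one fun S => ?_)
  exact (lintegral_potential_stateAfter_le hβ a b σ S k).trans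
    (inv_one_add_numRuinous_initialState_le _ hx)

open Classical in
theorem card_mul_lintegral_inv_one_add_le (x : X) :
    ((Finset.univ.filter fun i => ty i = x).card * ENNReal.ofReal (M.q₀ x)) *
      ∫⁻ a, (1 + ∑ i with ty i = x, (Set.Ioi (M.ruinThreshold x)).indicator 1 (a i))⁻¹
        ∂(Measure.pi fun i => M.shockLaw (ty i)) ≤ 1 := by
  let f : Fin n → (Fin n → ℝ) → ℝ≥0∞ := fun i a =>
    (Set.Ioi (M.ruinThreshold x)).indicator 1 (a i)
  have hind : Measurable ((Set.Ioi (M.ruinThreshold x)).indicator (1 : ℝ → ℝ≥0∞)) :=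
    measurable_one.indicator measurableSet_Ioi
  have hint : ∀ i, ty i = x →
      ∫⁻ a, f i a ∂(Measure.pi fun i => M.shockLaw (ty i)) = ENNReal.ofReal (M.q₀ x) := by
    rintro i rfl
    have hp := measurePreserving_eval (fun i => M.shockLaw (ty i)) i
    refine (hp.lintegral_comp hind).trans ?_
    rw [lintegral_indicator_one measurableSet_Ioi, M.shockLaw_Ioi_ruinThreshold]
  have h := sum_measure_mul_lintegral_inv_one_add_card_le
    (P := Measure.pi fun i => M.shockLaw (ty i))
    (Finset.univ.filter fun i => ty i = x) f (fun i => hind.comp (measurable_pi_apply i))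
    (iIndepFun_pi fun _ => hind.aemeasurable)
    (fun i a => by simp only [f, Set.indicator_apply]; split_ifs <;> simp)
  rwa [Finset.sum_congr rfl fun i hi => hint i (Finset.mem_filter.mp hi).2, Finset.sum_const,
    nsmul_eq_mul] at h

/-- A tail bound for the time of the last reveal, in terms of the agents of a single type. -/
theorem sampleLaw_time_le_le {β : ℝ} (hβ : 0 < β) (κ : Measure (Selector M ty))
    [IsProbabilityMeasure κ] {x : X} (hx : 0 < M.outDeg x) (t : ℝ) :
    sampleLaw M ty κ {ω | (stateAfter (networkIntensity β) ω
        (Fintype.card (OutHalf M ty))).time ≤ t} ≤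
      (ENNReal.ofReal (typeFraction ty x * n * M.q₀ x * Real.exp (-(β * t))))⁻¹ := by
  classical
  set N := Fintype.card (OutHalf M ty)
  set bad := {ω : Sample M ty | (stateAfter (networkIntensity β) ω N).time ≤ t}
  -- At the end `W = 0`, so the potential is exactly `exp (-β * time)`; Markov's inequality applies
  -- to it.
  have hpot : bad ⊆ {ω | ENNReal.ofReal (Real.exp (-(β * t))) ≤
      (stateAfter (networkIntensity β) ω N).potential β} := by
    intro ω hω
    have hω' : (stateAfter (networkIntensity β) ω N).time ≤ t := hω
    have hW : (stateAfter (networkIntensity β) ω N).numRuinous = 0 :=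
      Finset.card_eq_zero.mpr (ruinous_stateAfter_card _ ω)
    refine ENNReal.ofReal_le_ofReal ?_
    rw [hW]
    simp only [Nat.cast_zero, zero_add, div_one]
    gcongr
  have hmarkov : ENNReal.ofReal (Real.exp (-(β * t))) * sampleLaw M ty κ bad ≤ _ :=
    (mul_le_mul_right (measure_mono hpot) _).trans
      ((mul_meas_ge_le_lintegral (measurable_potential_stateAfter β N) _).trans
        (lintegral_potential_sampleLaw_le hβ κ hx N))
  have hfrac : ENNReal.ofReal (typeFraction ty x * n) =
      ((Finset.univ.filter fun i => ty i = x).card : ℝ≥0∞) := by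
    rw [← ENNReal.ofReal_natCast, typeFraction]
    congr 1
    rcases Nat.eq_zero_or_pos n with rfl | hn
    · simp
    · have : (n : ℝ) ≠ 0 := by positivity
      rw [div_mul_cancel₀ _ this]
  have hfn : 0 ≤ typeFraction ty x * n := by
    unfold typeFraction
    positivity
  rw [ENNReal.le_inv_iff_mul_le, mul_comm, ENNReal.ofReal_mul (mul_nonneg hfn (M.q₀_nonneg x)),
    ENNReal.ofReal_mul hfn, hfrac, mul_assoc]
  exact (mul_le_mul_right hmarkov _).trans (card_mul_lintegral_inv_one_add_le x)

/-- If the limiting initial intensity is positive, then there is a type of positive asymptotic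
frequency with outgoing half-edges and with a positive probability of initial ruin. -/
theorem Params.exists_type_of_initialIntensity_pos {M : Params X} {β : ℝ} {μ : X → ℝ}
    (hμ : ∀ x, 0 ≤ μ x) (h : 0 < M.initialIntensity β μ) :
    ∃ x, 0 < μ x ∧ 0 < M.outDeg x ∧ 0 < M.q₀ x := by
  have hne : ∑' x, μ x * M.outDeg x * M.q₀ x ≠ 0 := by
    intro h0
    simp [Params.initialIntensity, h0] at h
  obtain ⟨x, hx⟩ : ∃ x, μ x * M.outDeg x * M.q₀ x ≠ 0 := by
    by_contra! h0
    simp [h0] at hne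
  have hx1 := left_ne_zero_of_mul hx
  refine ⟨x, (hμ x).lt_of_ne' (left_ne_zero_of_mul hx1), ?_,
    (M.q₀_nonneg x).lt_of_ne' (right_ne_zero_of_mul hx)⟩
  exact Nat.pos_of_ne_zero (Nat.cast_ne_zero.mp (right_ne_zero_of_mul hx1))

end TailBound

end NetworkedRisk

theorem mainTheorem6 {X : Type*} [Countable X] (M : NetworkedRisk.Params X)
    (β : ℝ) (hβ : 0 < β)
    -- the types of the `n` agents, with equally many outgoing and incoming half-edges
    (ty : ∀ n : ℕ, Fin n → X)
    (hbal : ∀ n, ∑ i, M.inDeg (ty n i) = ∑ i, M.outDeg (ty n i))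
    -- the empirical distribution of types converges to a probability distribution
    (μ : X → ℝ) (hμ0 : ∀ x, 0 ≤ μ x) (hμ1 : HasSum μ 1)
    (hlim : ∀ x, Tendsto (fun n => NetworkedRisk.typeFraction (ty n) x) atTop (𝓝 (μ x)))
    -- the second moment condition on the degrees
    (hmom : (fun n => ∑ i, ((M.inDeg (ty n i) : ℝ) + M.outDeg (ty n i)) ^ 2)
      =O[atTop] (fun n : ℕ => (n : ℝ)))
    -- the limiting initial reveal intensity is positive
    (hR : 0 < M.initialIntensity β μ)
    -- arbitrary, possibly random, order of reveals
    (κ : ∀ n, Measure (NetworkedRisk.Selector M (ty n))) [∀ n, IsProbabilityMeasure (κ n)]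
    -- the randomness of the `n`-th network, on any probability space
    {Ω : ℕ → Type*} [∀ n, MeasurableSpace (Ω n)] (P : ∀ n, Measure (Ω n))
    [∀ n, IsProbabilityMeasure (P n)]
    (ξ : ∀ n, Ω n → NetworkedRisk.Sample M (ty n))
    (hξ : ∀ n, HasLaw (ξ n) (NetworkedRisk.sampleLaw M (ty n) (κ n)) (P n))
    (ε : ℝ) (hε : 0 < ε) :
    Tendsto
      (fun n : ℕ => P n {ω | (1 - ε) / β * Real.log n <
        NetworkedRisk.stoppingTime (NetworkedRisk.networkIntensity β) (ξ n ω)})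
      atTop (𝓝 1) := by
  obtain ⟨x, hμx, hdx, hqx⟩ := M.exists_type_of_initialIntensity_pos hμ0 hR
  -- Reciprocal of the tail bound at `t = (1 - ε) / β * log n`. The exponential is `n ^ ε / n`, so
  -- for `n > 0` this is the type fraction times `q₀ * n ^ ε`.
  let r : ℕ → ℝ := fun n => NetworkedRisk.typeFraction (ty n) x * n * M.q₀ x *
    Real.exp (-(β * ((1 - ε) / β * Real.log n)))
  have hr : Tendsto r atTop atTop := by
    have hpow : Tendsto (fun n : ℕ => (n : ℝ) ^ ε) atTop atTop :=
      (tendsto_rpow_atTop hε).comp tendsto_natCast_atTop_atTop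
    refine (Tendsto.pos_mul_atTop (mul_pos hμx hqx) ((hlim x).mul_const _) hpow).congr' ?_
    filter_upwards [eventually_gt_atTop 0] with n hn
    have hn' : (0 : ℝ) < n := by exact_mod_cast hn
    have h1 : -(β * ((1 - ε) / β * Real.log n)) = Real.log n * ε - Real.log n := by
      field_simp
      ring
    simp only [r]
    rw [h1, Real.exp_sub, Real.exp_log hn', Real.rpow_def_of_pos hn']
    field_simp
  have hbad : Tendsto (fun n => (ENNReal.ofReal (r n))⁻¹) atTop (𝓝 0) := by
    simpa using (ENNReal.tendsto_ofReal_nhds_top.mpr hr).inv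
  have hlow : Tendsto (fun n => 1 - (ENNReal.ofReal (r n))⁻¹) atTop (𝓝 1) := by
    simpa using ENNReal.Tendsto.sub (tendsto_const_nhds (x := (1 : ℝ≥0∞))) hbad
      (.inl ENNReal.one_ne_top)
  refine tendsto_of_tendsto_of_tendsto_of_le_of_le hlow tendsto_const_nhds (fun n => ?_)
    fun n => prob_le_one
  rw [tsub_le_iff_right]
  set good := {ω | (1 - ε) / β * Real.log n <
    NetworkedRisk.stoppingTime (NetworkedRisk.networkIntensity β) (ξ n ω)}
  let bad : Set (NetworkedRisk.Sample M (ty n)) :=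
    {ω | (NetworkedRisk.stateAfter (NetworkedRisk.networkIntensity β) ω
      (Fintype.card (NetworkedRisk.OutHalf M (ty n)))).time ≤ (1 - ε) / β * Real.log n}
  have hcover : Set.univ ⊆ good ∪ ξ n ⁻¹' bad := by
    intro ω _
    by_cases hω : ξ n ω ∈ bad
    · exact .inr hω
    · exact .inl (lt_of_lt_of_le (not_le.mp hω)
        (NetworkedRisk.time_stateAfter_card_le_stoppingTime _ _))
  calc (1 : ℝ≥0∞) = P n Set.univ := measure_univ.symm
    _ ≤ P n good + P n (ξ n ⁻¹' bad) := (measure_mono hcover).trans (measure_union_le _ _)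
    _ ≤ P n good + (ENNReal.ofReal (r n))⁻¹ := by
      gcongr
      -- This direction of the transfer to the law of `ξ n` requires no measurability of `bad`.
      refine (Measure.le_map_apply (hξ n).aemeasurable bad).trans ?_
      rw [(hξ n).map_eq]
      exact NetworkedRisk.sampleLaw_time_le_le hβ (κ n) hdx _
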